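/- Let $0<\theta<1$, $\varkappa>0$ and $\mathfrak A>0$ be fixed. For $T>1$ put $\xi=T^{\varkappa}$, $H=\mathfrak A/\log T$, and \[\mathcal M(x)=\frac1{\log\xi}\begin{cases}\log\xi & 1\le x\le \xi^\theta,\\ \frac1{1-\theta}\log(\xi/x) & \xi^\theta<x\le\xi,\\ 0 & x>\xi.\end{cases}\] Let $\tau_z$ denote the coefficients of the Dirichlet series of $\zeta^z$, i.e. the multiplicative function with $\tau_z(p^k)=z(z+1)\cdots(z+k-1)/k!$, and let $\phi$ be Euler's function. Write $\delta\mid d^\infty$ if every prime dividing $\delta$ divides $d$. For positive integers $q,d,\delta$ with $d\le T^{2\varkappa}$, $(q,d)=1$, $\delta\mid d^\infty$ and real $0\le v\le H$ put \[S_d(\delta,v)=\sum_{\substack{n\ge1\\(n,qd)=1}}\frac{\mathcal M(n\delta)\,\tau_{-1/2}(n\delta)}{n^{1+iv}}.\] Then, for any $c>0$, \[|S_d(\delta,v)|\le (1+o(1))\,\frac{\tau_{1/2}(\delta)}{1-\theta}\,\frac{e^{c}+e^{c\theta}}{2\sqrt{\pi\varkappa c}}\left(\sqrt{\frac{v\log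 T}{c}}\sqrt{\pi\varkappa}+\frac{\Gamma(1/4)}{\Gamma(3/4)}\right)\sqrt{\frac{dq}{\phi(d)\phi(q)\log T}}\qquad (T\to\infty),\] where the $o(1)$ depends only on $\varkappa,\theta,\mathfrak A$ and is uniform in $q,d,\delta,v,c$. In particular this holds for $c=\rho(v\log T,\theta)$, where for $u\ge0$ the number $\rho(u,\theta)$ (which also depends on $\varkappa$) is the only positive solution $X$ of \[e^{(1-\theta)X}\left[2X(a+b\sqrt X)-2a-b\sqrt X\right]+2\theta X(a+b\sqrt X)-2a-b\sqrt X=0,\qquad a=\sqrt{\pi\varkappa u},\quad b=\frac{\Gamma(1/4)}{\Gamma(3/4)}.\] This choice is optimal: for each $u=v\log T\ge0$, the right-hand side, as a function of $c>0$, attains its minimum at $c=\rho(u,\theta)$ and only there. -/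

import Mathlib

noncomputable section

/-- The generalized divisor function `τ_z`, the coefficients of the Dirichlet series of
`ζ(s)^z = ∏_p (1 - p^{-s})^{-z}`: it is multiplicative, with
`τ_z(p^k) = z (z + 1) ⋯ (z + k - 1) / k!`. -/
def tauZ (z : ℝ) (n : ℕ) : ℝ :=
  n.factorization.prod fun _ k => (∏ i ∈ Finset.range k, (z + i)) / (k.factorial : ℝ)

/-- The mollifier weight `𝓜(ξ, x)`, used for `x ≥ 1`. -/
def mollifier (θ ξ x : ℝ) : ℝ :=
  (1 / Real.log ξ) *
    (if x ≤ ξ ^ θ then Real.log ξ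
     else if x ≤ ξ then (1 / (1 - θ)) * Real.log (ξ / x)
     else 0)

/-- `a ∣ b^∞`: every prime dividing `a` divides `b`. -/
def DvdInfPow (a b : ℕ) : Prop := ∀ p : ℕ, p.Prime → p ∣ a → p ∣ b

/-- `S_d(δ, v) = ∑_{n ≥ 1, (n, qd) = 1} 𝓜(nδ) τ_{-1/2}(nδ) / n^{1 + iv}` with `ξ = T^ϰ`.
For `T > 1`, `ϰ > 0`, `0 < θ < 1` only the terms with `n δ ≤ ξ` are non-zero. -/
def twistedSum (ϰ θ T : ℝ) (q d δ : ℕ) (v : ℝ) : ℂ :=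
  ∑' n : ℕ, if 1 ≤ n ∧ Nat.Coprime n (q * d) then
    ((mollifier θ (T ^ ϰ) ((n * δ : ℕ) : ℝ) * tauZ (-1 / 2) (n * δ) : ℝ) : ℂ)
      / (n : ℂ) ^ (1 + Complex.I * (v : ℂ))
  else 0

/-- The constant `b = Γ(1/4) / Γ(3/4)`. -/
def gammaRatio : ℝ := Real.Gamma (1 / 4) / Real.Gamma (3 / 4)

/-- The part of the bound that depends on the free parameter `c`, with `u = v log T`. -/
def boundFactor (ϰ θ u c : ℝ) : ℝ :=
  (Real.exp c + Real.exp (c * θ)) / (2 * Real.sqrt (Real.pi * ϰ * c)) *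
    (Real.sqrt (u / c) * Real.sqrt (Real.pi * ϰ) + gammaRatio)

/-- The whole bound for `|S_d(δ, v)|`. -/
def sumBound (ϰ θ T : ℝ) (q d δ : ℕ) (v c : ℝ) : ℝ :=
  tauZ (1 / 2) δ / (1 - θ) * boundFactor ϰ θ (v * Real.log T) c *
    Real.sqrt ((d : ℝ) * (q : ℝ) /
      ((Nat.totient d : ℝ) * (Nat.totient q : ℝ) * Real.log T))

/-- The left-hand side of the equation for the optimal parameter, with
`a = √(π ϰ u)`, `b = Γ(1/4) / Γ(3/4)` and `u = v log T`. -/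
def optimalityFn (ϰ θ u X : ℝ) : ℝ :=
  let a := Real.sqrt (Real.pi * ϰ * u)
  let b := gammaRatio
  Real.exp ((1 - θ) * X) *
      (2 * X * (a + b * Real.sqrt X) - 2 * a - b * Real.sqrt X)
    + 2 * θ * X * (a + b * Real.sqrt X) - 2 * a - b * Real.sqrt X

end

/-! ### Coefficients of `ζ^z` and the identity `τ_{-1/2} * τ_{-1/2} = μ`. -/

section

open Finset

/-! The weight is a difference of two truncated logarithms, each an inverse Mellin transform with
kernel `1/s²`. Since `n` is coprime to `δ`, the factor `τ_{-1/2}(δ)` comes out, and the sum becomes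
an integral over `Re s = σ` of `F(1 + iv + s)` against that kernel, where `F` is the Dirichlet
series of `τ_{-1/2}` restricted to integers coprime to `N = qd` (`twistedSum_eq_integral`).

As `F² L(χ₀) = 1`, one has `|F|² ≤ (N/φ(N)) / |ζ|` to the right of `Re = 1`
(`norm_LSeries_coprimeTau_le`). No contour is moved: absolute values go inside the integral. Near
the pole `1/|ζ(1 + iv + s)|` is at most about `|s| + v`, whose square root is at most `|s|^{1/2} +
√v`. Integrating against `|s|^{-2}` gives the two terms `√π b/√σ` and `π√v/σ`; the rest of the line
costs only a small multiple of the first (`exists_integrable_majorant`). With `σ = c / log ξ` this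
is exactly the stated bound.

The estimate needs `σ` small, so it is not directly uniform in `c`. It is proved only at `c = ρ`,
which lies in `[1/2, 1/θ]` whatever `u` is; every other `c` gives a larger right-hand side because
`ρ` is the minimizer (`exists_optimal_parameter`). -/

/-- The local coefficient of `τ_z` is a signed generalized binomial coefficient. -/
theorem prod_add_div_factorial_eq_choose (z : ℝ) (k : ℕ) :
    (∏ i ∈ range k, (z + i)) / (k.factorial : ℝ) = (-1) ^ k * Ring.choose (-z) k := by
  have h : Ring.choose (-z) k = (k.factorial : ℝ)⁻¹ * ∏ i ∈ range k, (-z - i) := by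
    rw [Ring.choose_eq_smul, smul_eq_mul, ← descPochhammer_eval_eq_prod_range,
      ← Polynomial.aeval_eq_smeval, ← descPochhammer_map (algebraMap ℤ ℝ),
      Polynomial.eval_map_algebraMap]
  have h2 : ∏ i ∈ range k, (-z - (i : ℝ)) = (-1) ^ k * ∏ i ∈ range k, (z + i) := by
    rw [← card_range k, ← prod_const, card_range, ← prod_mul_distrib]
    exact prod_congr rfl fun i _ => by ring
  rw [h, h2, ← mul_assoc, mul_comm _ (_⁻¹), ← mul_assoc, mul_assoc (_⁻¹), ← mul_pow]
  field_simp
  norm_num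

theorem tauZ_mul_of_coprime (z : ℝ) {m n : ℕ} (h : m.Coprime n) :
    tauZ z (m * n) = tauZ z m * tauZ z n := by
  unfold tauZ
  rw [Nat.factorization_mul_of_coprime h]
  exact Finsupp.prod_add_index_of_disjoint (by simpa using h.disjoint_primeFactors) _

theorem tauZ_one (z : ℝ) : tauZ z 1 = 1 := by simp [tauZ]

theorem tauZ_prime_pow (z : ℝ) {p : ℕ} (hp : p.Prime) (k : ℕ) :
    tauZ z (p ^ k) = (∏ i ∈ range k, (z + i)) / (k.factorial : ℝ) := by
  rw [tauZ, hp.factorization_pow, Finsupp.prod_single_index (by simp)]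

theorem tauZ_half_nonneg (n : ℕ) : 0 ≤ tauZ (1 / 2) n := by
  unfold tauZ Finsupp.prod
  exact prod_nonneg fun p _ => div_nonneg (prod_nonneg fun i _ => by positivity) (by positivity)

/-- Factor by factor, `|-1/2 + i| ≤ 1/2 + i` for `i ≥ 0`. This is how `τ_{1/2}(δ)` enters the bound.
-/
theorem abs_tauZ_neg_half_le (n : ℕ) : |tauZ (-1 / 2) n| ≤ tauZ (1 / 2) n := by
  unfold tauZ Finsupp.prod
  rw [abs_prod]
  refine prod_le_prod (fun _ _ => abs_nonneg _) fun p _ => ?_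
  rw [abs_div, abs_prod, Nat.abs_cast]
  refine div_le_div_of_nonneg_right (prod_le_prod (fun _ _ => abs_nonneg _) fun i _ => ?_)
    (by positivity)
  rw [abs_le]
  constructor <;> linarith [(Nat.cast_nonneg i : (0 : ℝ) ≤ i)]

theorem tauZ_half_le_one (n : ℕ) : tauZ (1 / 2) n ≤ 1 := by
  unfold tauZ Finsupp.prod
  refine prod_le_one (fun p _ => div_nonneg (prod_nonneg fun i _ => by positivity) (by positivity))
    fun p _ => ?_
  rw [div_le_one (by positivity), ← prod_range_add_one_eq_factorial]
  push_cast
  refine prod_le_prod (fun i _ => by positivity) fun i _ => by linarith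

/-- `τ_z` as an arithmetic function. -/
noncomputable def tauArith (z : ℝ) : ArithmeticFunction ℝ := ⟨fun n => if n = 0 then 0 else tauZ z n, by simp⟩

theorem tauArith_apply (z : ℝ) {n : ℕ} (hn : n ≠ 0) : tauArith z n = tauZ z n := if_neg hn

theorem tauArith_isMultiplicative (z : ℝ) : (tauArith z).IsMultiplicative := by
  rw [ArithmeticFunction.IsMultiplicative.iff_ne_zero]
  refine ⟨by rw [tauArith_apply _ one_ne_zero, tauZ_one], fun {m n} hm hn h => ?_⟩
  rw [tauArith_apply _ (mul_ne_zero hm hn), tauArith_apply _ hm, tauArith_apply _ hn,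
    tauZ_mul_of_coprime _ h]

/-- The coefficient form of `(ζ^{-1/2})² = ζ^{-1}`. At a prime power it is Vandermonde's identity
for `1/2 + 1/2 = 1`, so only `k = 0, 1` survive. -/
theorem tauArith_neg_half_mul_self :
    tauArith (-1 / 2) * tauArith (-1 / 2) = (ArithmeticFunction.moebius : ArithmeticFunction ℝ) := by
  rw [ArithmeticFunction.IsMultiplicative.eq_iff_eq_on_prime_powers _
    ((tauArith_isMultiplicative _).mul (tauArith_isMultiplicative _)) _
    ArithmeticFunction.isMultiplicative_moebius.intCast]
  intro p k hp
  have key : (tauArith (-1 / 2) * tauArith (-1 / 2)) (p ^ k) = (-1) ^ k * (Nat.choose 1 k : ℝ) := by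
    have h : ∀ j, tauArith (-1 / 2) (p ^ j) = (-1) ^ j * Ring.choose (1 / 2 : ℝ) j := fun j => by
      rw [tauArith_apply _ (pow_ne_zero _ hp.ne_zero), tauZ_prime_pow _ hp,
        prod_add_div_factorial_eq_choose]
      norm_num
    rw [ArithmeticFunction.mul_apply, Nat.sum_divisorsAntidiagonal
      (fun i j => tauArith (-1 / 2) i * tauArith (-1 / 2) j), Nat.divisors_prime_pow hp, sum_map,
      ← Ring.choose_natCast, show ((1 : ℕ) : ℝ) = 1 / 2 + 1 / 2 by norm_num,
      Ring.add_choose_eq _ (Commute.all _ _), mul_sum,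
      Nat.sum_antidiagonal_eq_sum_range_succ_mk]
    refine sum_congr rfl fun i hi => ?_
    have hik : i ≤ k := Nat.lt_succ_iff.mp (mem_range.mp hi)
    simp only [Function.Embedding.coeFn_mk]
    rw [Nat.pow_div hik hp.pos, h, h]
    nth_rw 3 [← Nat.add_sub_cancel' hik]
    ring
  rw [key, ArithmeticFunction.intCoe_apply]
  rcases k with _ | _ | k
  · simp
  · simp [ArithmeticFunction.moebius_apply_prime hp]
  · rw [ArithmeticFunction.moebius_apply_prime_pow hp (by omega), Nat.choose_eq_zero_of_lt (by omega)]
    simp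

end

/-! ### The Dirichlet series of `τ_{-1/2}` over integers coprime to `N`, compared with `|ζ|^{-1/2}`.
-/

section

open Finset

/-- `τ_{-1/2}` twisted by the principal character mod `N`. -/
noncomputable def coprimeTau (N n : ℕ) : ℂ := (1 : DirichletCharacter ℂ N) n * (tauZ (-1 / 2) n : ℂ)

theorem norm_coprimeTau_le_one (N n : ℕ) : ‖coprimeTau N n‖ ≤ 1 := by
  rw [coprimeTau, norm_mul, Complex.norm_real, Real.norm_eq_abs]
  exact mul_le_one₀ (DirichletCharacter.norm_le_one _ _) (abs_nonneg _)
    ((abs_tauZ_neg_half_le n).trans (tauZ_half_le_one n))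

theorem coprimeTau_eq (N n : ℕ) :
    coprimeTau N n = if n.Coprime N then (tauZ (-1 / 2) n : ℂ) else 0 := by
  rw [coprimeTau]
  split_ifs with h
  · rw [MulChar.one_apply ((ZMod.isUnit_iff_coprime n N).mpr h), one_mul]
  · rw [MulChar.map_nonunit _ (fun hu => h ((ZMod.isUnit_iff_coprime n N).mp hu)), zero_mul]

theorem LSeriesSummable_coprimeTau (N : ℕ) {w : ℂ} (hw : 1 < w.re) :
    LSeriesSummable (coprimeTau N) w :=
  LSeriesSummable_of_bounded_of_one_lt_re (fun n _ => norm_coprimeTau_le_one N n) hw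

/-- Twisting by a completely multiplicative function distributes over convolution, so the squared
series is that of `χ₀ μ`, the inverse of `L(χ₀)`. This avoids choosing a branch of `ζ^{-1/2}`. -/
theorem LSeries_coprimeTau_sq (N : ℕ) {w : ℂ} (hw : 1 < w.re) :
    LSeries (fun n => (1 : DirichletCharacter ℂ N) n) w * LSeries (coprimeTau N) w ^ 2 = 1 := by
  let τ : ℕ → ℂ := fun n => ((tauArith (-1 / 2) n : ℝ) : ℂ)
  have hτ : LSeries.convolution τ τ = fun n => (ArithmeticFunction.moebius n : ℂ) := by
    funext n
    have h := congrArg (fun x : ℝ => (x : ℂ)) (DFunLike.congr_fun tauArith_neg_half_mul_self n)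
    simp only [ArithmeticFunction.mul_apply, ArithmeticFunction.intCoe_apply] at h
    rw [LSeries.convolution_def]
    push_cast at h
    exact h
  have hcongr : LSeries (coprimeTau N) w =
      LSeries ((fun n : ℕ => (1 : DirichletCharacter ℂ N) n) * τ) w := by
    refine LSeries_congr (fun {n} hn => ?_) w
    simp only [coprimeTau, Pi.mul_apply, τ, tauArith_apply _ hn]
  have hsum : LSeriesSummable ((fun n : ℕ => (1 : DirichletCharacter ℂ N) n) * τ) w := by
    refine (LSeriesSummable_congr w fun {n} hn => ?_).mp (LSeriesSummable_coprimeTau N hw)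
    simp only [coprimeTau, Pi.mul_apply, τ, tauArith_apply _ hn]
  rw [hcongr, sq, ← LSeries_convolution' hsum hsum, DirichletCharacter.mul_convolution_distrib, hτ]
  exact DirichletCharacter.LSeries.mul_mu_eq_one _ hw

/-- Each factor satisfies `|1 - p^{-w}| ≥ 1 - p^{-Re w} ≥ 1 - 1/p`. -/
theorem totient_div_le_norm_prod (N : ℕ) (hN : N ≠ 0) {w : ℂ} (hw : 1 < w.re) :
    (N.totient : ℝ) / N ≤ ‖∏ p ∈ N.primeFactors, (1 - (p : ℂ) ^ (-w))‖ := by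
  have h : (N.totient : ℝ) = N * ∏ p ∈ N.primeFactors, (1 - (p : ℝ)⁻¹) := by
    have h := congrArg (Rat.cast : ℚ → ℝ) (Nat.totient_eq_mul_prod_factors N)
    push_cast at h
    exact h
  have hN' : (N : ℝ) ≠ 0 := Nat.cast_ne_zero.mpr hN
  rw [h, mul_div_cancel_left₀ _ hN', norm_prod]
  refine prod_le_prod (fun p hp => ?_) fun p hp => ?_
  · have := (Nat.prime_of_mem_primeFactors hp).one_lt
    rw [sub_nonneg]
    exact inv_le_one_of_one_le₀ (by exact_mod_cast this.le)
  · have hp1 := (Nat.prime_of_mem_primeFactors hp).one_lt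
    have hp1' : (1 : ℝ) ≤ p := by exact_mod_cast hp1.le
    refine le_trans ?_ (norm_sub_norm_le _ _)
    rw [norm_one, Complex.norm_natCast_cpow_of_pos (by omega), ← Real.rpow_neg_one (p : ℝ)]
    gcongr
    simpa using hw.le

theorem norm_LSeries_coprimeTau_le (N : ℕ) (hN : N ≠ 0) {w : ℂ} (hw : 1 < w.re) :
    ‖LSeries (coprimeTau N) w‖ ≤ √((N : ℝ) / N.totient) * √(‖riemannZeta w‖⁻¹) := by
  have : NeZero N := ⟨hN⟩
  have hw1 : w ≠ 1 := fun h => by simp [h] at hw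
  have h := LSeries_coprimeTau_sq N hw
  rw [← DirichletCharacter.LFunction_eq_LSeries _ hw] at h
  have h2 := DirichletCharacter.LFunctionTrivChar_eq_mul_riemannZeta (N := N) hw1
  rw [DirichletCharacter.LFunctionTrivChar] at h2
  rw [h2] at h
  have h3 := congrArg norm h
  rw [norm_mul, norm_mul, norm_pow, norm_one] at h3
  have hφ : (0 : ℝ) < N.totient := by exact_mod_cast Nat.totient_pos.mpr (Nat.pos_of_ne_zero hN)
  have hNp : (0 : ℝ) < N := by exact_mod_cast Nat.pos_of_ne_zero hN
  have hζ : 0 < ‖riemannZeta w‖ :=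
    norm_pos_iff.mpr (riemannZeta_ne_zero_of_one_le_re hw.le)
  rw [← Real.sqrt_mul (by positivity)]
  refine Real.le_sqrt_of_sq_le ?_
  rw [← div_eq_mul_inv, le_div_iff₀ hζ, le_div_iff₀ hφ]
  have h4 := totient_div_le_norm_prod N hN hw
  rw [div_le_iff₀ hNp] at h4
  calc _ ≤ ‖LSeries (coprimeTau N) w‖ ^ 2 * ‖riemannZeta w‖ *
      (‖∏ p ∈ N.primeFactors, (1 - (p : ℂ) ^ (-w))‖ * N) := by gcongr
    _ = N := by linear_combination (N : ℝ) * h3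

end

/-! ### Integrals of `|s|^{-2}` and `|s|^{-3/2}` along a vertical line. -/

section

open MeasureTheory Set

theorem integrable_inv_sq_add_sq {a : ℝ} (ha : 0 < a) : Integrable fun t : ℝ => (a ^ 2 + t ^ 2)⁻¹ := by
  have h := (integrable_inv_one_add_sq.comp_mul_left' (inv_ne_zero ha.ne')).const_mul (a ^ 2)⁻¹
  refine h.congr (Filter.Eventually.of_forall fun t => ?_)
  simp only
  rw [← mul_inv]
  congr 1
  field_simp

theorem integral_univ_inv_sq_add_sq {a : ℝ} (ha : 0 < a) : ∫ t : ℝ, (a ^ 2 + t ^ 2)⁻¹ = Real.pi / a := by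
  have h : ∀ t : ℝ, (a ^ 2 + t ^ 2)⁻¹ = (a ^ 2)⁻¹ * (1 + (a⁻¹ * t) ^ 2)⁻¹ := fun t => by
    rw [← mul_inv]
    congr 1
    field_simp
  simp_rw [h]
  rw [integral_const_mul, Measure.integral_comp_mul_left (fun x : ℝ => (1 + x ^ 2)⁻¹),
    integral_univ_inv_one_add_sq, inv_inv, abs_of_pos ha, smul_eq_mul]
  field_simp

theorem integrable_one_add_sq_rpow : Integrable fun t : ℝ => (1 + t ^ 2) ^ (-(3 / 4) : ℝ) := by
  have h := integrable_rpow_neg_one_add_norm_sq (E := ℝ) (μ := volume) (r := 3 / 2) (by norm_num)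
  refine h.congr (Filter.Eventually.of_forall fun t => ?_)
  simp only [Real.norm_eq_abs, sq_abs]
  norm_num

theorem lintegral_rpow_mul_exp_neg_mul {a r : ℝ} (ha : 0 < a) (hr : 0 < r) :
    ∫⁻ x in Ioi (0 : ℝ), ENNReal.ofReal (x ^ (a - 1) * Real.exp (-(r * x))) =
      ENNReal.ofReal ((1 / r) ^ a * Real.Gamma a) := by
  have h := Real.integral_rpow_mul_exp_neg_mul_Ioi ha hr
  rw [← h, ofReal_integral_eq_lintegral_ofReal]
  · refine Integrable.of_integral_ne_zero ?_
    rw [h]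
    exact (mul_pos (by positivity) (Real.Gamma_pos_of_pos ha)).ne'
  · filter_upwards [ae_restrict_mem measurableSet_Ioi] with x hx
    have : 0 < x := hx
    simp only [Pi.zero_apply]
    positivity

theorem lintegral_exp_neg_mul_sq {b : ℝ} (hb : 0 < b) :
    ∫⁻ t : ℝ, ENNReal.ofReal (Real.exp (-b * t ^ 2)) = ENNReal.ofReal √(Real.pi / b) := by
  rw [← integral_gaussian, ofReal_integral_eq_lintegral_ofReal (integrable_exp_neg_mul_sq hb)]
  exact Filter.Eventually.of_forall fun _ => (Real.exp_pos _).le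

/-- Multiply by `Γ(3/4)` and write `Γ(3/4) (1 + t²)^{-3/4}` as an integral of `x^{-1/4} e^{-(1 +
t²)x}`. Integrating first over `t` gives the Gaussian `√(π/x)` and leaves `√π Γ(1/4)`. Lower
integrals make the exchange a matter of measurability alone. -/
theorem integral_one_add_sq_rpow :
    ∫ t : ℝ, (1 + t ^ 2) ^ (-(3 / 4) : ℝ) = √Real.pi * gammaRatio := by
  have hΓ : 0 < Real.Gamma (3 / 4) := Real.Gamma_pos_of_pos (by norm_num)
  have hΓ' : 0 < Real.Gamma (1 / 4) := Real.Gamma_pos_of_pos (by norm_num)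
  have key : (∫⁻ t : ℝ, ENNReal.ofReal ((1 + t ^ 2) ^ (-(3 / 4) : ℝ))) *
      ENNReal.ofReal (Real.Gamma (3 / 4)) = ENNReal.ofReal (√Real.pi * Real.Gamma (1 / 4)) := by
    rw [← lintegral_mul_const' _ _ ENNReal.ofReal_ne_top]
    calc _ = ∫⁻ t : ℝ, ∫⁻ x in Ioi (0 : ℝ),
          ENNReal.ofReal (x ^ ((3 / 4 : ℝ) - 1) * Real.exp (-((1 + t ^ 2) * x))) := by
          refine lintegral_congr fun t => ?_
          have ht : 0 < 1 + t ^ 2 := by positivity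
          rw [lintegral_rpow_mul_exp_neg_mul (by norm_num) ht,
            ← ENNReal.ofReal_mul (by positivity), one_div, Real.inv_rpow ht.le, Real.rpow_neg ht.le]
      _ = ∫⁻ x in Ioi (0 : ℝ), ∫⁻ t : ℝ,
          ENNReal.ofReal (x ^ ((3 / 4 : ℝ) - 1) * Real.exp (-((1 + t ^ 2) * x))) := by
          refine lintegral_lintegral_swap ?_
          exact Measurable.aemeasurable (by unfold Function.uncurry; fun_prop)
      _ = ∫⁻ x in Ioi (0 : ℝ),
          ENNReal.ofReal √Real.pi * ENNReal.ofReal (x ^ ((1 / 4 : ℝ) - 1) * Real.exp (-(1 * x))) := by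
          refine setLIntegral_congr_fun measurableSet_Ioi fun x hx => ?_
          have hx0 : 0 < x := hx
          have h1 : ∀ t : ℝ, ENNReal.ofReal (x ^ ((3 / 4 : ℝ) - 1) * Real.exp (-((1 + t ^ 2) * x))) =
              ENNReal.ofReal (x ^ ((3 / 4 : ℝ) - 1) * Real.exp (-x)) *
                ENNReal.ofReal (Real.exp (-x * t ^ 2)) := fun t => by
            rw [← ENNReal.ofReal_mul (by positivity), mul_assoc, ← Real.exp_add]
            ring_nf
          simp_rw [h1]
          rw [lintegral_const_mul' _ _ ENNReal.ofReal_ne_top, lintegral_exp_neg_mul_sq hx0,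
            ← ENNReal.ofReal_mul (by positivity), ← ENNReal.ofReal_mul (by positivity),
            Real.sqrt_div Real.pi_pos.le, Real.sqrt_eq_rpow x,
            show (1 / 4 : ℝ) - 1 = (3 / 4 - 1) - 1 / 2 by norm_num, Real.rpow_sub hx0 (3 / 4 - 1)]
          congr 1
          rw [one_mul]
          ring
      _ = _ := by
          rw [lintegral_const_mul' _ _ ENNReal.ofReal_ne_top,
            lintegral_rpow_mul_exp_neg_mul (by norm_num) one_pos,
            ← ENNReal.ofReal_mul (by positivity)]
          simp
  rw [integral_eq_lintegral_of_nonneg_ae (Filter.Eventually.of_forall fun t => by positivity)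
    integrable_one_add_sq_rpow.aestronglyMeasurable]
  have := congrArg ENNReal.toReal key
  rw [ENNReal.toReal_mul, ENNReal.toReal_ofReal hΓ.le, ENNReal.toReal_ofReal (by positivity)] at this
  rw [gammaRatio, ← mul_div_assoc, eq_div_iff hΓ.ne', this]

theorem sq_add_sq_rpow_eq {σ : ℝ} (hσ : 0 < σ) (t : ℝ) :
    (σ ^ 2 + t ^ 2) ^ (-(3 / 4) : ℝ) =
      σ ^ (-(3 / 2) : ℝ) * (1 + (σ⁻¹ * t) ^ 2) ^ (-(3 / 4) : ℝ) := by
  have h : σ ^ 2 + t ^ 2 = σ ^ 2 * (1 + (σ⁻¹ * t) ^ 2) := by field_simp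
  rw [h, Real.mul_rpow (by positivity) (by positivity), ← Real.rpow_natCast σ 2, ← Real.rpow_mul hσ.le]
  norm_num

theorem integrable_sq_add_sq_rpow {σ : ℝ} (hσ : 0 < σ) :
    Integrable fun t : ℝ => (σ ^ 2 + t ^ 2) ^ (-(3 / 4) : ℝ) := by
  simp_rw [sq_add_sq_rpow_eq hσ]
  exact (integrable_one_add_sq_rpow.comp_mul_left' (inv_ne_zero hσ.ne')).const_mul _

theorem integral_sq_add_sq_rpow {σ : ℝ} (hσ : 0 < σ) :
    ∫ t : ℝ, (σ ^ 2 + t ^ 2) ^ (-(3 / 4) : ℝ) = √Real.pi * gammaRatio / √σ := by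
  simp_rw [sq_add_sq_rpow_eq hσ]
  rw [integral_const_mul, Measure.integral_comp_mul_left (fun x : ℝ => (1 + x ^ 2) ^ (-(3 / 4) : ℝ)),
    integral_one_add_sq_rpow, inv_inv, abs_of_pos hσ, smul_eq_mul,
    eq_div_iff (Real.sqrt_pos.mpr hσ).ne', Real.sqrt_eq_rpow σ]
  have h : σ ^ (-(3 / 2) : ℝ) * σ * σ ^ (1 / 2 : ℝ) = 1 := by
    rw [← Real.rpow_add_one hσ.ne', ← Real.rpow_add hσ]
    norm_num
  linear_combination (√Real.pi * gammaRatio) * h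

theorem gammaRatio_pos : 0 < gammaRatio :=
  div_pos (Real.Gamma_pos_of_pos (by norm_num)) (Real.Gamma_pos_of_pos (by norm_num))

end

/-! ### Bounds for `1/ζ` to the right of `Re = 1`, and the majorant on the line. -/

section

open Filter Topology MeasureTheory

/-- The pole at `1` is simple with residue `1`. -/
theorem exists_norm_inv_zeta_le_near_one {ε : ℝ} (hε : 0 < ε) :
    ∃ η > 0, ∀ w : ℂ, w ≠ 1 → ‖w - 1‖ < η → ‖riemannZeta w‖⁻¹ ≤ (1 + ε) * ‖w - 1‖ := by
  have h := riemannZeta_residue_one.norm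
  rw [norm_one] at h
  have h1 : (1 + ε)⁻¹ < 1 := inv_lt_one_of_one_lt₀ (by linarith)
  obtain ⟨η, hη, H⟩ := Metric.mem_nhdsWithin_iff.mp (h.eventually (lt_mem_nhds h1))
  refine ⟨η, hη, fun w hw hwη => ?_⟩
  have h2 : (1 + ε)⁻¹ < ‖(w - 1) * riemannZeta w‖ := H ⟨by rwa [Metric.mem_ball, dist_eq_norm], hw⟩
  rw [norm_mul] at h2
  have h3 : 0 < ‖w - 1‖ := norm_pos_iff.mpr (sub_ne_zero.mpr hw)
  have h4 : 0 < ‖riemannZeta w‖ := by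
    by_contra h5
    have : ‖riemannZeta w‖ = 0 := le_antisymm (not_lt.mp h5) (norm_nonneg _)
    rw [this, mul_zero] at h2
    exact absurd h2 (not_lt.mpr (by positivity))
  rw [inv_le_iff_one_le_mul₀ h4]
  rw [inv_lt_iff_one_lt_mul₀ (by positivity)] at h2
  linarith

/-- Compactness together with the nonvanishing of `ζ` on `Re ≥ 1`. The region includes the line `Re
= 1`, so `K` does not depend on `σ`. -/
theorem exists_norm_inv_zeta_le_of_im_mem {η Y : ℝ} (hη : 0 < η) :
    ∃ K : ℝ, 0 < K ∧ ∀ w : ℂ, 1 ≤ w.re → w.re ≤ 2 → η ≤ |w.im| → |w.im| ≤ Y →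
      ‖riemannZeta w‖⁻¹ ≤ K := by
  let S : Set ℂ := (Set.Icc 1 2) ×ℂ {y : ℝ | η ≤ |y| ∧ |y| ≤ Y}
  have hS : IsCompact S := by
    refine isCompact_Icc.reProdIm ?_
    refine (isCompact_Icc (a := -Y) (b := Y)).of_isClosed_subset ?_ fun y hy => abs_le.mp hy.2
    exact (isClosed_le continuous_const continuous_abs).inter
      (isClosed_le continuous_abs continuous_const)
  have hc : ContinuousOn (fun w => ‖riemannZeta w‖⁻¹) S := by
    intro w hw
    rw [Complex.mem_reProdIm] at hw
    have hne : w ≠ 1 := fun h => by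
      have := hw.2.1
      rw [h, Complex.one_im, abs_zero] at this
      linarith
    exact ((differentiableAt_riemannZeta hne).continuousAt.norm.inv₀
      (norm_ne_zero_iff.mpr (riemannZeta_ne_zero_of_one_le_re hw.1.1))).continuousWithinAt
  obtain ⟨K, hK⟩ := hS.bddAbove_image hc
  refine ⟨max K 1, by positivity, fun w h1 h2 h3 h4 => le_max_of_le_left (hK ⟨w, ?_, rfl⟩)⟩
  exact Complex.mem_reProdIm.mpr ⟨⟨h1, h2⟩, h3, h4⟩

/-- Termwise from `1/ζ = ∑ μ(n) n^{-w}` and `|μ| ≤ 1`. -/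
theorem norm_inv_zeta_le_zeta_re {w : ℂ} (hw : 1 < w.re) :
    ‖riemannZeta w‖⁻¹ ≤ ‖riemannZeta (w.re : ℂ)‖ := by
  have h1 := ArithmeticFunction.LSeries_zeta_mul_Lseries_moebius hw
  rw [ArithmeticFunction.LSeries_zeta_eq_riemannZeta hw] at h1
  have hre : 1 < (w.re : ℂ).re := by simpa using hw
  rw [← norm_inv, ← eq_inv_of_mul_eq_one_right h1, LSeries, zeta_eq_tsum_one_div_nat_cpow hre]
  have hs : Summable fun n : ℕ => 1 / (n : ℝ) ^ w.re := Real.summable_one_div_nat_rpow.mpr hw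
  have h2 : (∑' n : ℕ, 1 / (n : ℂ) ^ (w.re : ℂ)) = ((∑' n : ℕ, 1 / (n : ℝ) ^ w.re : ℝ) : ℂ) := by
    rw [Complex.ofReal_tsum]
    refine tsum_congr fun n => ?_
    rw [Complex.ofReal_div, Complex.ofReal_cpow (Nat.cast_nonneg n)]
    simp
  rw [h2, Complex.norm_real, Real.norm_eq_abs]
  refine le_trans (tsum_of_norm_bounded hs.hasSum fun n => ?_) (le_abs_self _)
  rw [LSeries.norm_term_eq]
  split_ifs with hn
  · positivity
  · gcongr
    rw [Complex.norm_intCast]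
    exact_mod_cast ArithmeticFunction.abs_moebius_le_one

/-- Serves for large imaginary part, where compactness is unavailable. The function `(s - 1) ζ(s)`,
extended by `1` at `s = 1`, is continuous, hence bounded on `[1, 2]`. -/
theorem exists_norm_inv_zeta_le_inv_re_sub_one :
    ∃ C : ℝ, 0 < C ∧ ∀ w : ℂ, 1 < w.re → w.re ≤ 2 → ‖riemannZeta w‖⁻¹ ≤ C / (w.re - 1) := by
  let h : ℂ → ℂ := Function.update (fun s => (s - 1) * riemannZeta s) 1 1
  have hc : Continuous h := by
    refine continuous_iff_continuousAt.mpr fun s => ?_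
    rcases eq_or_ne s 1 with rfl | hs
    · exact continuousAt_update_same.mpr riemannZeta_residue_one
    · rw [continuousAt_update_of_ne hs]
      exact (continuousAt_id.sub continuousAt_const).mul
        (differentiableAt_riemannZeta hs).continuousAt
  obtain ⟨C, hC⟩ := (isCompact_Icc (a := (1 : ℝ)) (b := 2)).bddAbove_image
    (hc.norm.comp Complex.continuous_ofReal).continuousOn
  refine ⟨max C 1, by positivity, fun w h1 h2 => (norm_inv_zeta_le_zeta_re h1).trans ?_⟩
  rw [le_div_iff₀ (by linarith)]
  refine le_max_of_le_left (le_trans (le_of_eq ?_) (hC ⟨w.re, ⟨h1.le, h2⟩, rfl⟩))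
  have hne : (w.re : ℂ) ≠ 1 := by exact_mod_cast h1.ne'
  simp only [Function.comp_apply, h]
  rw [Function.update_of_ne hne, norm_mul, mul_comm,
    show ((w.re : ℂ) - 1) = ((w.re - 1 : ℝ) : ℂ) by push_cast; rfl, Complex.norm_real, Real.norm_eq_abs,
    abs_of_pos (by linarith)]

/-- Away from `t = 0` this trades `|s|^{-2}` for a function whose integral does not grow as `σ → 0`.
-/
theorem inv_sq_add_sq_le_two_mul {σ t a : ℝ} (ha : 0 < a) (h : a ≤ |t|) :
    (σ ^ 2 + t ^ 2)⁻¹ ≤ 2 * (a ^ 2 + t ^ 2)⁻¹ := by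
  have h1 : a ^ 2 ≤ t ^ 2 := by
    rw [← sq_abs t]
    gcongr
  have h2 : 0 < a ^ 2 := by positivity
  have h3 : 0 < σ ^ 2 + t ^ 2 := by linarith [sq_nonneg σ]
  rw [← div_eq_mul_inv, inv_eq_one_div, div_le_div_iff₀ h3 (by positivity)]
  nlinarith [sq_nonneg σ]

theorem integral_add_add_add {f₁ f₂ f₃ f₄ : ℝ → ℝ} (h₁ : Integrable f₁) (h₂ : Integrable f₂)
    (h₃ : Integrable f₃) (h₄ : Integrable f₄) :
    ∫ t, (f₁ t + f₂ t + f₃ t + f₄ t) = (∫ t, f₁ t) + (∫ t, f₂ t) + (∫ t, f₃ t) + ∫ t, f₄ t := by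
  have h₁₂ : Integrable fun t => f₁ t + f₂ t := h₁.add h₂
  have h₁₂₃ : Integrable fun t => f₁ t + f₂ t + f₃ t := h₁₂.add h₃
  rw [integral_add h₁₂₃ h₄, integral_add h₁₂ h₃, integral_add h₁ h₂]

/-- An integrable majorant of the shifted `|ζ|^{-1/2} / |s|²` on the line `Re s = σ`,
whose integral is asymptotically the one coming from the pole of `ζ`. -/
theorem exists_integrable_majorant {ε : ℝ} (hε : 0 < ε) :
    ∃ σ₀ > 0, ∃ v₀ > 0, ∀ σ v : ℝ, 0 < σ → σ ≤ σ₀ → 0 ≤ v → v ≤ v₀ → ∃ g : ℝ → ℝ, Integrable g ∧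
      (∀ t : ℝ, √(‖riemannZeta (1 + Complex.I * v + (σ + t * Complex.I))‖⁻¹) / (σ ^ 2 + t ^ 2) ≤ g t) ∧
      ∫ t, g t ≤ (1 + ε) * (√Real.pi * gammaRatio / √σ + Real.pi * √v / σ) := by
  have hb := gammaRatio_pos
  have hπ := Real.pi_pos
  obtain ⟨C, hC, HC⟩ := exists_norm_inv_zeta_le_inv_re_sub_one
  obtain ⟨η, hη, Hη⟩ := exists_norm_inv_zeta_le_near_one (ε := ε / 2) (by positivity)
  -- `κ / √σ` is `ε / 4` of the main term. The middle and far ranges may each cost that much, and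
  -- the near range carries the factor `1 + ε / 2`, for a total of `1 + ε`.
  set κ := ε / 4 * (√Real.pi * gammaRatio) with hκ
  have hκ0 : 0 < κ := by positivity
  -- In the far range the majorant integrates to `2 √(C/σ) π / y`, which this `y` makes equal to `κ
  -- / √σ`.
  set y : ℝ := 2 * √C * Real.pi / κ with hy
  have hy0 : 0 < y := by positivity
  obtain ⟨K, hK, HK⟩ := exists_norm_inv_zeta_le_of_im_mem (η := η / 2) (Y := 2 * y) (by positivity)
  set a := η / 4 with ha
  have ha0 : 0 < a := by positivity
  set B := 2 * √K * Real.pi / a with hB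
  have hB0 : 0 < B := by positivity
  -- The middle range costs the constant `B`, and `σ ≤ (κ / B)²` turns this into `B ≤ κ / √σ`. The
  -- bounds `v ≤ a` and `v ≤ y` convert lower bounds on `|v + t|` into lower bounds on `|t|`.
  refine ⟨min (min 1 (η / 4)) ((κ / B) ^ 2), by positivity, min a y, by positivity, ?_⟩
  intro σ v hσ hσ₀ hv hv₀
  have hσ1 : σ ≤ 1 := hσ₀.trans ((min_le_left _ _).trans (min_le_left _ _))
  have hση : σ ≤ η / 4 := hσ₀.trans ((min_le_left _ _).trans (min_le_right _ _))
  have hσB : √σ ≤ κ / B := Real.sqrt_le_iff.mpr ⟨by positivity, hσ₀.trans (min_le_right _ _)⟩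
  have hva : v ≤ a := hv₀.trans (min_le_left _ _)
  have hvy : v ≤ y := hv₀.trans (min_le_right _ _)
  have hi1 := integrable_sq_add_sq_rpow hσ
  have hi2 := integrable_inv_sq_add_sq hσ
  have hi3 := integrable_inv_sq_add_sq ha0
  have hi4 := integrable_inv_sq_add_sq hy0
  refine ⟨fun t => (((1 + ε / 2) * (σ ^ 2 + t ^ 2) ^ (-(3 / 4) : ℝ) +
    ((1 + ε / 2) * √v) * (σ ^ 2 + t ^ 2)⁻¹) + (√K * 2) * (a ^ 2 + t ^ 2)⁻¹) +
    (√(C / σ) * 2) * (y ^ 2 + t ^ 2)⁻¹, ?_, ?_, ?_⟩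
  · exact (((hi1.const_mul _).add (hi2.const_mul _)).add (hi3.const_mul _)).add (hi4.const_mul _)
  · intro t
    set w : ℂ := 1 + Complex.I * v + (σ + t * Complex.I) with hw
    have hwre : w.re = 1 + σ := by simp [hw]
    have hwim : w.im = v + t := by simp [hw]
    have hw1 : w ≠ 1 := fun h => by
      rw [h, Complex.one_re] at hwre
      linarith
    have hs : 0 < σ ^ 2 + t ^ 2 := by positivity
    have p1 : 0 ≤ (1 + ε / 2) * (σ ^ 2 + t ^ 2) ^ (-(3 / 4) : ℝ) := by positivity
    have p2 : 0 ≤ ((1 + ε / 2) * √v) * (σ ^ 2 + t ^ 2)⁻¹ := by positivity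
    have p3 : 0 ≤ (√K * 2) * (a ^ 2 + t ^ 2)⁻¹ := by positivity
    have p4 : 0 ≤ (√(C / σ) * 2) * (y ^ 2 + t ^ 2)⁻¹ := by positivity
    rw [div_eq_mul_inv]
    rcases lt_or_ge |v + t| (η / 2) with h1 | h1
    · have hnear : ‖w - 1‖ < η := by
        refine (Complex.norm_le_abs_re_add_abs_im _).trans_lt ?_
        rw [Complex.sub_re, Complex.sub_im, hwre, hwim, Complex.one_re, Complex.one_im, sub_zero,
          add_sub_cancel_left, abs_of_pos hσ]
        linarith
      have hnorm : ‖w - 1‖ ≤ √(σ ^ 2 + t ^ 2) + v := by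
        have h2 : w - 1 = (σ + t * Complex.I) + (v : ℂ) * Complex.I := by rw [hw]; ring
        rw [h2]
        refine (norm_add_le _ _).trans (le_of_eq ?_)
        rw [Complex.norm_add_mul_I]
        simp [abs_of_nonneg hv]
      have h5 : √(‖riemannZeta w‖⁻¹) ≤ (1 + ε / 2) * ((σ ^ 2 + t ^ 2) ^ (1 / 4 : ℝ) + √v) := by
        have e1 : (σ ^ 2 + t ^ 2) ^ (1 / 4 : ℝ) = √√(σ ^ 2 + t ^ 2) := by
          rw [Real.sqrt_eq_rpow, Real.sqrt_eq_rpow, ← Real.rpow_mul hs.le]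
          norm_num
        rw [e1]
        refine Real.sqrt_le_iff.mpr ⟨by positivity, (Hη w hw1 hnear).trans ?_⟩
        have e2 := Real.sq_sqrt (Real.sqrt_nonneg (σ ^ 2 + t ^ 2))
        have e3 := Real.sq_sqrt hv
        -- Subadditivity of the square root, in squared form; it separates the `|s|` and `v`
        -- contributions.
        have e4 : √(σ ^ 2 + t ^ 2) + v ≤ (√√(σ ^ 2 + t ^ 2) + √v) ^ 2 := by
          nlinarith [mul_nonneg (Real.sqrt_nonneg √(σ ^ 2 + t ^ 2)) (Real.sqrt_nonneg v)]
        rw [mul_pow]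
        refine mul_le_mul (by nlinarith) (hnorm.trans e4) (norm_nonneg _) (by positivity)
      have h6 : (σ ^ 2 + t ^ 2) ^ (1 / 4 : ℝ) * (σ ^ 2 + t ^ 2)⁻¹ =
          (σ ^ 2 + t ^ 2) ^ (-(3 / 4) : ℝ) := by
        rw [← Real.rpow_neg_one (σ ^ 2 + t ^ 2), ← Real.rpow_add hs]
        norm_num
      have h7 := mul_le_mul_of_nonneg_right h5 (inv_nonneg.mpr hs.le)
      have h8 : (1 + ε / 2) * ((σ ^ 2 + t ^ 2) ^ (1 / 4 : ℝ) + √v) * (σ ^ 2 + t ^ 2)⁻¹ =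
          (1 + ε / 2) * (σ ^ 2 + t ^ 2) ^ (-(3 / 4) : ℝ) +
            (1 + ε / 2) * √v * (σ ^ 2 + t ^ 2)⁻¹ := by
        rw [← h6]
        ring
      linarith
    · rcases le_or_gt |v + t| (2 * y) with h2 | h2
      · have h3 : √(‖riemannZeta w‖⁻¹) ≤ √K :=
          Real.sqrt_le_sqrt (HK w (by linarith) (by linarith) (by rwa [hwim]) (by rwa [hwim]))
        have h4 : a ≤ |t| := by
          have := abs_add_le v t
          rw [abs_of_nonneg hv] at this
          linarith
        have h7 := mul_le_mul h3 (inv_sq_add_sq_le_two_mul (σ := σ) ha0 h4) (by positivity)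
          (by positivity)
        linarith
      · have h3 : √(‖riemannZeta w‖⁻¹) ≤ √(C / σ) := by
          refine Real.sqrt_le_sqrt ((HC w (by linarith) (by linarith)).trans_eq ?_)
          rw [hwre, add_sub_cancel_left]
        have h4 : y ≤ |t| := by
          have := abs_add_le v t
          rw [abs_of_nonneg hv] at this
          linarith
        have h7 := mul_le_mul h3 (inv_sq_add_sq_le_two_mul (σ := σ) hy0 h4) (by positivity)
          (by positivity)
        linarith
  · rw [integral_add_add_add (hi1.const_mul _) (hi2.const_mul _) (hi3.const_mul _)
      (hi4.const_mul _), integral_const_mul, integral_const_mul,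
      integral_const_mul, integral_const_mul, integral_sq_add_sq_rpow hσ,
      integral_univ_inv_sq_add_sq hσ, integral_univ_inv_sq_add_sq ha0, integral_univ_inv_sq_add_sq hy0]
    have hsσ : 0 < √σ := Real.sqrt_pos.mpr hσ
    have e1 : √K * 2 * (Real.pi / a) ≤ κ / √σ := by
      rw [le_div_iff₀ hsσ]
      have : √K * 2 * (Real.pi / a) = B := by rw [hB]; ring
      rw [this, mul_comm]
      exact (le_div_iff₀ hB0).mp hσB
    have e2 : √(C / σ) * 2 * (Real.pi / y) = κ / √σ := by
      have hCs : 0 < √C := Real.sqrt_pos.mpr hC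
      rw [Real.sqrt_div hC.le, hy]
      field_simp
    have e3 : κ / √σ = ε / 4 * (√Real.pi * gammaRatio / √σ) := by rw [hκ]; ring
    have e4 : 0 ≤ ε * (Real.pi * √v / σ) := by positivity
    rw [e2, e3]
    rw [e3] at e1
    have e5 : (1 + ε / 2) * √v * (Real.pi / σ) = (1 + ε / 2) * (Real.pi * √v / σ) := by ring
    rw [e5]
    linarith

end

/-! ### Perron's formula and the integral representation of the sum. -/

section

open Filter Topology MeasureTheory

/-- A factor `log t` differentiates a Mellin transform, and that of the indicator of `(0, 1]` is
`1/s`. -/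
theorem hasMellin_log_smul_one_Ioc {s : ℂ} (hs : 0 < s.re) :
    HasMellin (fun t : ℝ => Real.log t • Set.indicator (Set.Ioc 0 1) (fun _ => (1 : ℂ)) t) s
      (-1 / s ^ 2) := by
  have hs0 : s ≠ 0 := fun h => by simp [h] at hs
  have hbound : ∀ t : ℝ, ‖Set.indicator (Set.Ioc 0 1) (fun _ => (1 : ℂ)) t‖ ≤ 1 := fun t =>
    (norm_indicator_le_norm_self _ _).trans (by simp)
  obtain ⟨h1, h2⟩ := mellin_hasDerivAt_of_isBigO_rpow (s := s) (a := s.re + 1) (b := 0)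
    (f := Set.indicator (Set.Ioc 0 1) (fun _ => (1 : ℂ)))
    (((integrable_indicator_iff measurableSet_Ioc).mpr
      (integrableOn_const (by simp))).locallyIntegrable.locallyIntegrableOn _)
    (by
      refine Asymptotics.IsBigO.of_bound 1 ?_
      filter_upwards [eventually_gt_atTop 1] with t ht
      rw [Set.indicator_of_notMem (fun h => absurd h.2 (not_le.mpr ht))]
      simp)
    (by linarith)
    (by
      refine Asymptotics.IsBigO.of_bound 1 (Eventually.of_forall fun t => ?_)
      simpa using hbound t)
    hs
  refine ⟨h1, ?_⟩
  rw [← h2.deriv]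
  have h3 : mellin (Set.indicator (Set.Ioc 0 1) (fun _ => (1 : ℂ))) =ᶠ[𝓝 s] fun z => z⁻¹ := by
    filter_upwards [(isOpen_lt continuous_const Complex.continuous_re).mem_nhds hs] with z hz
    rw [(hasMellin_one_Ioc hz).2, one_div]
  rw [h3.deriv_eq, deriv_inv, neg_div, one_div]

theorem verticalLine_ne_zero {σ : ℝ} (hσ : 0 < σ) (t : ℝ) : (σ + t * Complex.I : ℂ) ≠ 0 := fun h => by
  have := congrArg Complex.re h
  simp at this
  exact hσ.ne' this

theorem norm_verticalLine_sq (σ t : ℝ) : ‖(σ + t * Complex.I : ℂ)‖ ^ 2 = σ ^ 2 + t ^ 2 := by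
  rw [Complex.norm_add_mul_I, Real.sq_sqrt (by positivity)]

theorem continuous_one_div_verticalLine_sq {σ : ℝ} (hσ : 0 < σ) :
    Continuous fun t : ℝ => 1 / (σ + t * Complex.I : ℂ) ^ 2 :=
  continuous_const.div (by fun_prop) fun t => pow_ne_zero 2 (verticalLine_ne_zero hσ t)

theorem integrable_one_div_verticalLine_sq {σ : ℝ} (hσ : 0 < σ) :
    Integrable fun t : ℝ => 1 / (σ + t * Complex.I : ℂ) ^ 2 := by
  refine (integrable_inv_sq_add_sq hσ).mono'
    (continuous_one_div_verticalLine_sq hσ).aestronglyMeasurable (Eventually.of_forall fun t => ?_)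
  rw [norm_div, norm_one, norm_pow, norm_verticalLine_sq, one_div]

/-- Perron's formula with kernel `1 / s²`. -/
theorem integral_cpow_div_sq {σ x : ℝ} (hσ : 0 < σ) (hx : 0 < x) :
    ∫ t : ℝ, (x : ℂ) ^ (-(σ + t * Complex.I)) * (1 / (σ + t * Complex.I) ^ 2) =
      ((2 * Real.pi * max (-Real.log x) 0 : ℝ) : ℂ) := by
  set F : ℝ → ℂ := fun t => Real.log t • Set.indicator (Set.Ioc 0 1) (fun _ => (1 : ℂ)) t with hF
  have hFeq : ∀ y : ℝ, 0 < y → F y = ((-max (-Real.log y) 0 : ℝ) : ℂ) := fun y hy => by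
    rcases le_or_gt y 1 with h | h
    · rw [hF, max_eq_left (neg_nonneg.mpr (Real.log_nonpos hy.le h))]
      simp only [Set.indicator_of_mem (show y ∈ Set.Ioc (0 : ℝ) 1 from ⟨hy, h⟩)]
      simp
    · rw [hF, max_eq_right (neg_nonpos.mpr (Real.log_nonneg h.le))]
      simp only [Set.indicator_of_notMem (fun h' : y ∈ Set.Ioc (0 : ℝ) 1 => absurd h'.2 (not_le.mpr h))]
      simp
  have hmel : ∀ t : ℝ, mellin F (σ + t * Complex.I) = -(1 / (σ + t * Complex.I) ^ 2) := fun t => by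
    rw [(hasMellin_log_smul_one_Ioc (s := σ + t * Complex.I) (by simpa using hσ)).2, neg_div]
  have hcont : ContinuousAt F x := by
    -- Mellin inversion requires continuity at `x`. The factor `log` vanishes at the jump of the
    -- indicator, so `F` is continuous at `1` too.
    have h1 : F =ᶠ[𝓝 x] fun y => ((-max (-Real.log y) 0 : ℝ) : ℂ) := by
      filter_upwards [lt_mem_nhds hx] with y hy using hFeq y hy
    refine ContinuousAt.congr ?_ h1.symm
    exact Complex.continuous_ofReal.continuousAt.comp
      ((((Real.continuousAt_log hx.ne').neg).max continuousAt_const).neg)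
  have hconv : MellinConvergent F σ := (hasMellin_log_smul_one_Ioc (s := σ) (by simpa using hσ)).1
  have h := mellinInv_mellin_eq σ F hx hconv
    (by
      rw [Complex.VerticalIntegrable]
      simp_rw [hmel]
      exact (integrable_one_div_verticalLine_sq hσ).neg)
    hcont
  rw [mellinInv, hFeq x hx] at h
  simp_rw [hmel, smul_neg, integral_neg, smul_eq_mul] at h
  have hπ : (Real.pi : ℂ) ≠ 0 := Complex.ofReal_ne_zero.mpr Real.pi_ne_zero
  rw [Complex.real_smul] at h
  generalize ∫ t : ℝ, (x : ℂ) ^ (-(σ + t * Complex.I)) * (1 / (σ + t * Complex.I) ^ 2) = J at h ⊢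
  push_cast at h ⊢
  field_simp at h
  linear_combination -h

/-- The plateau followed by a logarithmic slope is a difference of two ramps: below `ξ^θ` their
slopes cancel and leave `(1 - θ) log ξ`. -/
theorem mollifier_eq {θ ξ x : ℝ} (hθ0 : 0 < θ) (hθ1 : θ < 1) (hξ : 1 < ξ) (hx : 0 < x) :
    mollifier θ ξ x = 1 / ((1 - θ) * Real.log ξ) *
      (max (-Real.log (x / ξ)) 0 - max (-Real.log (x / ξ ^ θ)) 0) := by
  have hξ0 : 0 < ξ := by linarith
  have hl : 0 < Real.log ξ := Real.log_pos hξ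
  have hθ' : 0 < 1 - θ := by linarith
  have hlt : ξ ^ θ < ξ := by
    nth_rw 2 [← Real.rpow_one ξ]
    exact Real.rpow_lt_rpow_of_exponent_lt hξ hθ1
  have hp : 0 < ξ ^ θ := by positivity
  rw [mollifier, Real.log_div hx.ne' hξ0.ne', Real.log_div hx.ne' hp.ne', Real.log_rpow hξ0]
  split_ifs with h1 h2
  · have e1 := Real.log_le_log hx h1
    rw [Real.log_rpow hξ0] at e1
    rw [max_eq_left (by nlinarith), max_eq_left (by linarith)]
    field_simp
    ring
  · have e1 := Real.log_le_log hp (not_le.mp h1).le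
    rw [Real.log_rpow hξ0] at e1
    have e2 := Real.log_le_log hx h2
    rw [max_eq_left (by linarith), max_eq_right (by linarith), Real.log_div hξ0.ne' hx.ne']
    field_simp
    ring
  · have e1 := Real.log_le_log hp (not_le.mp h1).le
    rw [Real.log_rpow hξ0] at e1
    have e2 := Real.log_le_log hξ0 (not_le.mp h2).le
    rw [max_eq_right (by linarith), max_eq_right (by linarith)]
    ring

/-- The Mellin kernel of the mollifier dilated by `δ`. -/
noncomputable def mollifierKernel (θ ξ : ℝ) (δ : ℕ) (s : ℂ) : ℂ :=
  (((δ / ξ : ℝ) : ℂ) ^ (-s) - ((δ / ξ ^ θ : ℝ) : ℂ) ^ (-s)) * (1 / s ^ 2)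

/-- Since `δ ≥ 1`, the factor `δ^{-σ}` is simply dropped. -/
theorem norm_mollifierKernel_le {θ ξ σ : ℝ} {δ : ℕ} (hξ : 1 < ξ) (hδ : 1 ≤ δ) (hσ : 0 < σ) (t : ℝ) :
    ‖mollifierKernel θ ξ δ (σ + t * Complex.I)‖ ≤ (ξ ^ σ + ξ ^ (θ * σ)) * (σ ^ 2 + t ^ 2)⁻¹ := by
  have hξ0 : 0 < ξ := by linarith
  have hδ' : (1 : ℝ) ≤ δ := by exact_mod_cast hδ
  have hδ0 : (0 : ℝ) < δ := by linarith
  have key : ∀ y : ℝ, 0 < y → ‖((δ / y : ℝ) : ℂ) ^ (-(σ + t * Complex.I))‖ ≤ y ^ σ := fun y hy => by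
    rw [Complex.norm_cpow_eq_rpow_re_of_pos (by positivity)]
    have : (-(σ + t * Complex.I) : ℂ).re = -σ := by simp
    rw [this, Real.rpow_neg (by positivity), ← Real.inv_rpow (by positivity), inv_div]
    exact Real.rpow_le_rpow (by positivity) (div_le_self hy.le hδ') hσ.le
  rw [mollifierKernel, norm_mul, norm_div, norm_one, norm_pow, norm_verticalLine_sq, one_div]
  gcongr
  refine (norm_sub_le _ _).trans (add_le_add (key ξ hξ0) ((key _ (by positivity)).trans_eq ?_))
  rw [← Real.rpow_mul hξ0.le]

theorem continuous_mollifierKernel {θ ξ σ : ℝ} {δ : ℕ} (hξ : 1 < ξ) (hδ : 1 ≤ δ) (hσ : 0 < σ) :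
    Continuous fun t : ℝ => mollifierKernel θ ξ δ (σ + t * Complex.I) := by
  have hξ0 : 0 < ξ := by linarith
  have hδ0 : (0 : ℝ) < δ := by exact_mod_cast hδ
  have key : ∀ y : ℝ, 0 < y →
      Continuous fun t : ℝ => ((δ / y : ℝ) : ℂ) ^ (-(σ + t * Complex.I)) := fun y hy =>
    Continuous.const_cpow (by fun_prop) (Or.inl (Complex.ofReal_ne_zero.mpr (by positivity)))
  exact ((key ξ hξ0).sub (key _ (by positivity))).mul (continuous_one_div_verticalLine_sq hσ)

theorem integrable_mollifierKernel {θ ξ σ : ℝ} {δ : ℕ} (hξ : 1 < ξ) (hδ : 1 ≤ δ) (hσ : 0 < σ) :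
    Integrable fun t : ℝ => mollifierKernel θ ξ δ (σ + t * Complex.I) :=
  ((integrable_inv_sq_add_sq hσ).const_mul _).mono'
    (continuous_mollifierKernel hξ hδ hσ).aestronglyMeasurable
    (Eventually.of_forall fun t => norm_mollifierKernel_le hξ hδ hσ t)

theorem integral_cpow_mul_mollifierKernel {θ ξ σ : ℝ} {δ n : ℕ} (hθ0 : 0 < θ) (hθ1 : θ < 1)
    (hξ : 1 < ξ) (hδ : 1 ≤ δ) (hσ : 0 < σ) (hn : 1 ≤ n) :
    ∫ t : ℝ, (n : ℂ) ^ (-(σ + t * Complex.I)) * mollifierKernel θ ξ δ (σ + t * Complex.I) =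
      ((2 * Real.pi * ((1 - θ) * Real.log ξ) * mollifier θ ξ ((n * δ : ℕ) : ℝ) : ℝ) : ℂ) := by
  have hξ0 : 0 < ξ := by linarith
  have hδ0 : (0 : ℝ) < δ := by exact_mod_cast hδ
  have hn0 : (0 : ℝ) < n := by exact_mod_cast hn
  have hl : 0 < Real.log ξ := Real.log_pos hξ
  have hθ' : 0 < 1 - θ := by linarith
  have hint : ∀ x : ℝ, 0 < x → Integrable fun t : ℝ =>
      (x : ℂ) ^ (-(σ + t * Complex.I)) * (1 / (σ + t * Complex.I) ^ 2) := fun x hx => by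
    refine (integrable_one_div_verticalLine_sq hσ).bdd_mul (c := x ^ (-σ)) ?_ ?_
    · exact (Continuous.const_cpow (by fun_prop)
        (Or.inl (Complex.ofReal_ne_zero.mpr hx.ne'))).aestronglyMeasurable
    · refine Eventually.of_forall fun t => ?_
      rw [Complex.norm_cpow_eq_rpow_re_of_pos hx]
      simp
  have hmul : ∀ y : ℝ, 0 < y → ∀ s : ℂ,
      (n : ℂ) ^ s * ((δ / y : ℝ) : ℂ) ^ s = ((((n * δ : ℕ) : ℝ) / y : ℝ) : ℂ) ^ s := fun y hy s => by
    rw [← Complex.ofReal_natCast n, ← Complex.mul_cpow_ofReal_nonneg hn0.le (by positivity)]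
    push_cast
    ring_nf
  have hsplit : ∀ t : ℝ,
      (n : ℂ) ^ (-(σ + t * Complex.I) : ℂ) * mollifierKernel θ ξ δ (σ + t * Complex.I) =
      ((((n * δ : ℕ) : ℝ) / ξ : ℝ) : ℂ) ^ (-(σ + t * Complex.I)) * (1 / (σ + t * Complex.I) ^ 2) -
      ((((n * δ : ℕ) : ℝ) / ξ ^ θ : ℝ) : ℂ) ^ (-(σ + t * Complex.I)) *
        (1 / (σ + t * Complex.I) ^ 2) := fun t => by
    rw [← hmul ξ hξ0, ← hmul (ξ ^ θ) (by positivity), mollifierKernel]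
    ring
  have hnδ : (0 : ℝ) < ((n * δ : ℕ) : ℝ) := by push_cast; positivity
  simp_rw [hsplit]
  rw [integral_sub (hint _ (by positivity)) (hint _ (by positivity)),
    integral_cpow_div_sq hσ (by positivity), integral_cpow_div_sq hσ (by positivity),
    mollifier_eq hθ0 hθ1 hξ hnδ, ← Complex.ofReal_sub]
  congr 1
  field_simp

theorem coprime_of_dvdInfPow {n δ d : ℕ} (h : DvdInfPow δ d) (hn : n.Coprime d) : n.Coprime δ :=
  Nat.Coprime.symm (Nat.coprime_of_dvd fun p hp hpδ hpn =>
    hp.one_lt.ne' (Nat.dvd_one.mp (hn ▸ Nat.dvd_gcd hpn (h p hp hpδ))))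

/-- The contour-integral representation of the twisted sum. -/
theorem twistedSum_eq_integral {ϰ θ T σ v : ℝ} {q d δ : ℕ} (hθ0 : 0 < θ) (hθ1 : θ < 1)
    (hξ : 1 < T ^ ϰ) (hδ : 1 ≤ δ) (hδd : DvdInfPow δ d) (hσ : 0 < σ) :
    twistedSum ϰ θ T q d δ v =
      ((tauZ (-1 / 2) δ / (2 * Real.pi * ((1 - θ) * Real.log (T ^ ϰ))) : ℝ) : ℂ) *
        ∫ t : ℝ, LSeries (coprimeTau (q * d)) (1 + Complex.I * v + (σ + t * Complex.I)) *
          mollifierKernel θ (T ^ ϰ) δ (σ + t * Complex.I) := by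
  set ξ := T ^ ϰ
  have hl : 0 < Real.log ξ := Real.log_pos hξ
  have hθ' : 0 < 1 - θ := by linarith
  have hre : ∀ t : ℝ, (1 + Complex.I * v + (σ + t * Complex.I) : ℂ).re = 1 + σ := fun t => by simp
  let F : ℕ → ℝ → ℂ := fun n t =>
    LSeries.term (coprimeTau (q * d)) (1 + Complex.I * v + (σ + t * Complex.I)) n *
      mollifierKernel θ ξ δ (σ + t * Complex.I)
  have hterm : ∀ {n : ℕ}, n ≠ 0 → ∀ t : ℝ,
      LSeries.term (coprimeTau (q * d)) (1 + Complex.I * v + (σ + t * Complex.I)) n =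
        coprimeTau (q * d) n / (n : ℂ) ^ (1 + Complex.I * v) *
          (n : ℂ) ^ (-(σ + t * Complex.I)) := fun {n} hn t => by
    rw [LSeries.term_of_ne_zero hn, Complex.cpow_add _ _ (Nat.cast_ne_zero.mpr hn), Complex.cpow_neg]
    field_simp
  -- The modulus of the `n`-th Dirichlet term is constant along the line, so absolute convergence at
  -- `1 + σ` justifies exchanging sum and integral.
  have hnorm : ∀ n t, ‖F n t‖ = ‖LSeries.term (coprimeTau (q * d)) (1 + σ : ℝ) n‖ *
      ‖mollifierKernel θ ξ δ (σ + t * Complex.I)‖ := fun n t => by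
    simp only [F, norm_mul]
    rw [LSeries.norm_term_eq, LSeries.norm_term_eq, hre, Complex.ofReal_re]
  have hFi : ∀ n, Integrable (F n) := fun n => by
    refine (integrable_mollifierKernel hξ hδ hσ).bdd_mul
      (c := ‖LSeries.term (coprimeTau (q * d)) (1 + σ : ℝ) n‖) ?_ ?_
    · refine Continuous.aestronglyMeasurable ?_
      rcases eq_or_ne n 0 with rfl | hn
      · simp only [LSeries.term_zero]
        exact continuous_const
      · simp_rw [hterm hn]
        exact continuous_const.mul (Continuous.const_cpow (by fun_prop)
          (Or.inl (Nat.cast_ne_zero.mpr hn)))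
    · refine Eventually.of_forall fun t => le_of_eq ?_
      rw [LSeries.norm_term_eq, LSeries.norm_term_eq, hre, Complex.ofReal_re]
  have hFs : Summable fun n => ∫ t, ‖F n t‖ := by
    simp_rw [hnorm, integral_const_mul]
    exact (LSeriesSummable_coprimeTau (q * d) (w := (1 + σ : ℝ))
      (by rw [Complex.ofReal_re]; linarith)).norm.mul_right _
  have hsum := (hasSum_integral_of_summable_integral_norm hFi hFs).tsum_eq
  have hR : ∀ t : ℝ, ∑' n, F n t =
      LSeries (coprimeTau (q * d)) (1 + Complex.I * v + (σ + t * Complex.I)) *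
          mollifierKernel θ ξ δ (σ + t * Complex.I) := fun t => by
    rw [LSeries, ← tsum_mul_right]
  simp_rw [hR] at hsum
  rw [← hsum, ← tsum_mul_left, twistedSum]
  refine tsum_congr fun n => ?_
  rcases Nat.eq_zero_or_pos n with rfl | hn
  · simp [F]
  · have hFn : ∫ t, F n t = coprimeTau (q * d) n / (n : ℂ) ^ (1 + Complex.I * v) *
        ((2 * Real.pi * ((1 - θ) * Real.log ξ) * mollifier θ ξ ((n * δ : ℕ) : ℝ) : ℝ) : ℂ) := by
      rw [← integral_cpow_mul_mollifierKernel hθ0 hθ1 hξ hδ hσ hn, ← integral_const_mul]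
      refine integral_congr_ae (Eventually.of_forall fun t => ?_)
      simp only [F]
      rw [hterm hn.ne', mul_assoc]
    rw [hFn, coprimeTau_eq]
    by_cases hc : n.Coprime (q * d)
    · have hnδ : n.Coprime δ := coprime_of_dvdInfPow hδd (Nat.Coprime.coprime_mul_left_right hc)
      rw [if_pos ⟨hn, hc⟩, if_pos hc, tauZ_mul_of_coprime _ hnδ]
      have hπ : (Real.pi : ℂ) ≠ 0 := Complex.ofReal_ne_zero.mpr Real.pi_ne_zero
      have h1 : ((1 - θ : ℝ) : ℂ) ≠ 0 := Complex.ofReal_ne_zero.mpr hθ'.ne'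
      have h2 : (Real.log ξ : ℂ) ≠ 0 := Complex.ofReal_ne_zero.mpr hl.ne'
      push_cast at h1 ⊢
      field_simp
      rw [show T ^ ϰ = ξ from rfl]
      ring
    · rw [if_neg (fun h => hc h.2), if_neg hc]
      simp

theorem norm_twistedSum_le {ϰ θ T σ v : ℝ} {q d δ : ℕ} {g : ℝ → ℝ} (hθ0 : 0 < θ) (hθ1 : θ < 1)
    (hξ : 1 < T ^ ϰ) (hqd : q * d ≠ 0) (hδ : 1 ≤ δ) (hδd : DvdInfPow δ d) (hσ : 0 < σ)
    (hg : Integrable g)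
    (hζg : ∀ t : ℝ,
      √(‖riemannZeta (1 + Complex.I * v + (σ + t * Complex.I))‖⁻¹) / (σ ^ 2 + t ^ 2) ≤ g t) :
    ‖twistedSum ϰ θ T q d δ v‖ ≤ tauZ (1 / 2) δ / (2 * Real.pi * ((1 - θ) * Real.log (T ^ ϰ))) *
      (√((q * d : ℕ) / (q * d).totient) * ((T ^ ϰ) ^ σ + (T ^ ϰ) ^ (θ * σ)) * ∫ t, g t) := by
  have hl : 0 < Real.log (T ^ ϰ) := Real.log_pos hξ
  have hθ' : 0 < 1 - θ := by linarith
  have hπ := Real.pi_pos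
  have hξ0 : 0 < T ^ ϰ := by linarith
  rw [twistedSum_eq_integral hθ0 hθ1 hξ hδ hδd hσ, norm_mul, Complex.norm_real, Real.norm_eq_abs,
    abs_div, abs_of_pos (show 0 < 2 * Real.pi * ((1 - θ) * Real.log (T ^ ϰ)) by positivity),
    ← integral_const_mul]
  refine mul_le_mul (div_le_div_of_nonneg_right (abs_tauZ_neg_half_le δ) (by positivity)) ?_
    (norm_nonneg _) (div_nonneg (tauZ_half_nonneg δ) (by positivity))
  refine norm_integral_le_of_norm_le (hg.const_mul _) (Eventually.of_forall fun t => ?_)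
  have h1 := norm_LSeries_coprimeTau_le (q * d) hqd
    (w := 1 + Complex.I * v + (σ + t * Complex.I)) (by simpa using hσ)
  have h2 := norm_mollifierKernel_le (θ := θ) hξ hδ hσ t
  rw [norm_mul]
  refine (mul_le_mul h1 h2 (norm_nonneg _) (by positivity)).trans ?_
  calc _ = √((q * d : ℕ) / (q * d).totient) * ((T ^ ϰ) ^ σ + (T ^ ϰ) ^ (θ * σ)) *
      (√(‖riemannZeta (1 + Complex.I * v + (σ + t * Complex.I))‖⁻¹) / (σ ^ 2 + t ^ 2)) := by ring
    _ ≤ _ := mul_le_mul_of_nonneg_left (hζg t) (by positivity)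

end

/-! ### The equation for the optimal parameter and the minimum of the bound. -/

section

open Set

theorem optimalityFn_eq (ϰ θ u X : ℝ) :
    optimalityFn ϰ θ u X =
      Real.exp ((1 - θ) * X) * (2 * X * (√(Real.pi * ϰ * u) + gammaRatio * √X) -
        2 * √(Real.pi * ϰ * u) - gammaRatio * √X) +
      2 * θ * X * (√(Real.pi * ϰ * u) + gammaRatio * √X) - 2 * √(Real.pi * ϰ * u) -
        gammaRatio * √X := rfl

/-- Both fractions are nondecreasing and `2X` is strictly increasing. Dividing the optimality
equation by positive factors turns it into "this function equals `1`", whence uniqueness of the root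
and the sign on either side. -/
theorem strictMonoOn_optimality_ratio {a b θ : ℝ} (ha : 0 ≤ a) (hb : 0 < b) (hθ0 : 0 < θ)
    (hθ1 : θ < 1) :
    StrictMonoOn (fun X => 2 * X * (((a + b * √X) / (2 * a + b * √X)) *
      ((Real.exp ((1 - θ) * X) + θ) / (Real.exp ((1 - θ) * X) + 1)))) (Ioi 0) := by
  intro X hX Y hY hXY
  have hX0 : 0 < X := hX
  have hY0 : 0 < Y := hY
  have hs : √X < √Y := Real.sqrt_lt_sqrt hX0.le hXY
  have hsX : 0 < √X := Real.sqrt_pos.mpr hX0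
  have hsY : 0 < √Y := Real.sqrt_pos.mpr hY0
  have hE : Real.exp ((1 - θ) * X) ≤ Real.exp ((1 - θ) * Y) :=
    Real.exp_le_exp.mpr (mul_le_mul_of_nonneg_left hXY.le (by linarith))
  have h1 : (a + b * √X) / (2 * a + b * √X) ≤ (a + b * √Y) / (2 * a + b * √Y) := by
    rw [div_le_div_iff₀ (by positivity) (by positivity)]
    nlinarith [mul_nonneg (mul_nonneg ha hb.le) (sub_nonneg.mpr hs.le)]
  have h2 : (Real.exp ((1 - θ) * X) + θ) / (Real.exp ((1 - θ) * X) + 1) ≤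
      (Real.exp ((1 - θ) * Y) + θ) / (Real.exp ((1 - θ) * Y) + 1) := by
    rw [div_le_div_iff₀ (by positivity) (by positivity)]
    nlinarith [mul_nonneg (sub_nonneg.mpr hθ1.le) (sub_nonneg.mpr hE)]
  exact mul_lt_mul (by linarith) (mul_le_mul h1 h2 (by positivity) (by positivity)) (by positivity)
    (by positivity)

theorem optimalityFn_eq_ratio_sub_one {ϰ θ u X : ℝ} (hX : 0 < X) :
    optimalityFn ϰ θ u X = (2 * X * (((√(Real.pi * ϰ * u) + gammaRatio * √X) /
      (2 * √(Real.pi * ϰ * u) + gammaRatio * √X)) *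
      ((Real.exp ((1 - θ) * X) + θ) / (Real.exp ((1 - θ) * X) + 1))) - 1) *
      ((2 * √(Real.pi * ϰ * u) + gammaRatio * √X) * (Real.exp ((1 - θ) * X) + 1)) := by
  have hsX : 0 < √X := Real.sqrt_pos.mpr hX
  have hb := gammaRatio_pos
  have h1 : 2 * √(Real.pi * ϰ * u) + gammaRatio * √X ≠ 0 := by positivity
  have h2 : Real.exp ((1 - θ) * X) + 1 ≠ 0 := by positivity
  rw [optimalityFn_eq]
  field_simp
  ring

theorem boundFactor_eq {ϰ θ u c : ℝ} (hϰ : 0 < ϰ) (hu : 0 ≤ u) (hc : 0 < c) :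
    boundFactor ϰ θ u c = 1 / (2 * √(Real.pi * ϰ)) *
      ((Real.exp c + Real.exp (c * θ)) * (√(Real.pi * ϰ * u) + gammaRatio * √c) / c) := by
  have hπ := Real.pi_pos
  have hp : 0 < √(Real.pi * ϰ) := Real.sqrt_pos.mpr (by positivity)
  have hs : 0 < √c := Real.sqrt_pos.mpr hc
  rw [boundFactor, Real.sqrt_mul (by positivity) c, Real.sqrt_mul (by positivity) u, Real.sqrt_div hu]
  field_simp
  rw [Real.sq_sqrt hc.le]

theorem hasDerivAt_boundFactor {ϰ θ u c : ℝ} (hϰ : 0 < ϰ) (hu : 0 ≤ u) (hc : 0 < c) :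
    HasDerivAt (boundFactor ϰ θ u)
      (1 / (2 * √(Real.pi * ϰ)) * (Real.exp (c * θ) / (2 * c ^ 2)) * optimalityFn ϰ θ u c) c := by
  have hs : 0 < √c := Real.sqrt_pos.mpr hc
  have h1 : HasDerivAt (fun x => Real.exp x + Real.exp (x * θ))
      (Real.exp c + Real.exp (c * θ) * (1 * θ)) c :=
    (Real.hasDerivAt_exp c).add ((hasDerivAt_id c).mul_const θ).exp
  have h2 : HasDerivAt (fun x => √(Real.pi * ϰ * u) + gammaRatio * √x)
      (gammaRatio * (1 / (2 * √c))) c :=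
    ((Real.hasDerivAt_sqrt hc.ne').const_mul _).const_add _
  have h := ((h1.mul h2).div (hasDerivAt_id c) hc.ne').const_mul (1 / (2 * √(Real.pi * ϰ)))
  have heq : boundFactor ϰ θ u =ᶠ[nhds c] fun x => 1 / (2 * √(Real.pi * ϰ)) *
      ((Real.exp x + Real.exp (x * θ)) * (√(Real.pi * ϰ * u) + gammaRatio * √x) / x) := by
    filter_upwards [lt_mem_nhds hc] with x hx using boundFactor_eq hϰ hu hx
  refine (HasDerivAt.congr_of_eventuallyEq h heq).congr_deriv ?_
  have hexp : Real.exp c = Real.exp (c * θ) * Real.exp ((1 - θ) * c) := by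
    rw [← Real.exp_add]
    ring_nf
  simp only [id, Pi.mul_apply]
  rw [optimalityFn_eq, hexp, mul_assoc (1 / _)]
  congr 1
  have hsq : √c * √c = c := Real.mul_self_sqrt hc.le
  -- With `c = r²` the identity becomes rational in `r`.
  generalize √c = r at hs hsq ⊢
  subst hsq
  field_simp
  ring

/-- The derivative of the bound is a positive multiple of `optimalityFn`, which changes sign exactly
once, from negative to positive. The upper bound `1 / θ` does not depend on `u`; it supplies the
uniformity in the final estimate. -/
theorem exists_optimal_parameter {ϰ θ u : ℝ} (hϰ : 0 < ϰ) (hθ0 : 0 < θ) (hθ1 : θ < 1) (hu : 0 ≤ u) :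
    ∃ r : ℝ, (1 / 2 ≤ r ∧ r ≤ 1 / θ) ∧ optimalityFn ϰ θ u r = 0 ∧
      (∀ X : ℝ, 0 < X → optimalityFn ϰ θ u X = 0 → X = r) ∧
      (∀ c : ℝ, 0 < c → c ≠ r → boundFactor ϰ θ u r < boundFactor ϰ θ u c) := by
  have hb := gammaRatio_pos
  have hmono := strictMonoOn_optimality_ratio (Real.sqrt_nonneg (Real.pi * ϰ * u)) hb hθ0 hθ1
  set R : ℝ → ℝ := fun X => 2 * X * (((√(Real.pi * ϰ * u) + gammaRatio * √X) /
      (2 * √(Real.pi * ϰ * u) + gammaRatio * √X)) *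
      ((Real.exp ((1 - θ) * X) + θ) / (Real.exp ((1 - θ) * X) + 1))) with hR
  have hF : ∀ X : ℝ, 0 < X → ∃ k : ℝ, 0 < k ∧ optimalityFn ϰ θ u X = (R X - 1) * k := fun X hX => by
    have hsX : 0 < √X := Real.sqrt_pos.mpr hX
    exact ⟨_, by positivity, optimalityFn_eq_ratio_sub_one hX⟩
  have hcont : Continuous (optimalityFn ϰ θ u) := by
    have : optimalityFn ϰ θ u = _ := funext fun X => optimalityFn_eq ϰ θ u X
    rw [this]
    fun_prop
  have ha := Real.sqrt_nonneg (Real.pi * ϰ * u)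
  -- At `X = 1/2` the bracket after the exponential collapses to `-a`; at `X = 1/θ` the part without
  -- the exponential collapses to `b√X`.
  have hlow : optimalityFn ϰ θ u (1 / 2) ≤ 0 := by
    rw [optimalityFn_eq]
    have hs : 0 < gammaRatio * √(1 / 2) := by positivity
    have h1 := mul_nonneg (Real.exp_pos ((1 - θ) * (1 / 2))).le ha
    nlinarith [mul_nonneg (sub_nonneg.mpr hθ1.le) hs.le, mul_nonneg (sub_nonneg.mpr hθ1.le) ha]
  have hhigh : 0 ≤ optimalityFn ϰ θ u (1 / θ) := by
    rw [optimalityFn_eq]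
    have hs : 0 < gammaRatio * √(1 / θ) := by positivity
    have hθ' : 1 ≤ 1 / θ := (one_le_div hθ0).mpr hθ1.le
    have h2 : 0 ≤ 2 * (1 / θ) * (√(Real.pi * ϰ * u) + gammaRatio * √(1 / θ)) -
        2 * √(Real.pi * ϰ * u) - gammaRatio * √(1 / θ) := by
      nlinarith [mul_nonneg (sub_nonneg.mpr hθ') (add_nonneg ha hs.le)]
    have h1 := mul_nonneg (Real.exp_pos ((1 - θ) * (1 / θ))).le h2
    have h3 : 2 * θ * (1 / θ) = 2 := by field_simp
    rw [h3]
    linarith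
  have hle : (1 : ℝ) / 2 ≤ 1 / θ := one_div_le_one_div_of_le hθ0 (by linarith)
  obtain ⟨r, hr, hr0⟩ := intermediate_value_Icc hle hcont.continuousOn ⟨hlow, hhigh⟩
  have hrpos : 0 < r := lt_of_lt_of_le (by norm_num) hr.1
  have hRr : R r = 1 := by
    obtain ⟨k, hk, h⟩ := hF r hrpos
    rw [h] at hr0
    linarith [(mul_eq_zero.mp hr0).resolve_right hk.ne']
  have hπ := Real.pi_pos
  have hneg : ∀ X, 0 < X → X < r → deriv (boundFactor ϰ θ u) X < 0 := fun X hX hXr => by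
    obtain ⟨k, hk, h⟩ := hF X hX
    have h1 : R X < R r := hmono hX hrpos hXr
    rw [(hasDerivAt_boundFactor hϰ hu hX).deriv, h]
    exact mul_neg_of_pos_of_neg (by positivity) (mul_neg_of_neg_of_pos (by linarith) hk)
  have hpos : ∀ X, r < X → 0 < deriv (boundFactor ϰ θ u) X := fun X hXr => by
    have hX := hrpos.trans hXr
    obtain ⟨k, hk, h⟩ := hF X hX
    have h1 : R r < R X := hmono hrpos hX hXr
    rw [(hasDerivAt_boundFactor hϰ hu hX).deriv, h]
    exact mul_pos (by positivity) (mul_pos (by linarith) hk)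
  refine ⟨r, hr, hr0, fun X hX hX0 => ?_, fun c hc hcr => ?_⟩
  · obtain ⟨k, hk, h⟩ := hF X hX
    rw [h] at hX0
    have : R X = 1 := by linarith [(mul_eq_zero.mp hX0).resolve_right hk.ne']
    exact hmono.injOn hX hrpos (this.trans hRr.symm)
  · rcases lt_or_gt_of_ne hcr with h | h
    · refine strictAntiOn_of_deriv_neg (convex_Ioc 0 r) (fun x hx =>
        (hasDerivAt_boundFactor hϰ hu hx.1).continuousAt.continuousWithinAt) (fun x hx => ?_)
        ⟨hc, h.le⟩ ⟨hrpos, le_rfl⟩ h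
      rw [interior_Ioc] at hx
      exact hneg x hx.1 hx.2
    · refine strictMonoOn_of_deriv_pos (convex_Ici r) (fun x hx =>
        (hasDerivAt_boundFactor hϰ hu (hrpos.trans_le hx)).continuousAt.continuousWithinAt)
        (fun x hx => ?_) (mem_Ici.mpr le_rfl) (mem_Ici.mpr h.le) h
      rw [interior_Ici] at hx
      exact hpos x hx

end

/-! ### Assembling the bound. -/

/-- The choice `σ = c / (ϰ log T) = c / log ξ` gives `ξ^σ = e^c` and matches the integral estimate
with the stated bound exactly. Coprimality is used for `φ(qd) = φ(q)φ(d)`. -/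
theorem sumBound_eq {ϰ θ T v c : ℝ} {q d δ : ℕ} (hϰ : 0 < ϰ) (hθ1 : θ < 1) (hT : 1 < T)
    (hqd : q.Coprime d) (hv : 0 ≤ v) (hc : 0 < c) :
    sumBound ϰ θ T q d δ v c =
      tauZ (1 / 2) δ / (2 * Real.pi * ((1 - θ) * Real.log (T ^ ϰ))) *
        (√((q * d : ℕ) / (q * d).totient) *
          ((T ^ ϰ) ^ (c / (ϰ * Real.log T)) + (T ^ ϰ) ^ (θ * (c / (ϰ * Real.log T)))) *
          (√Real.pi * gammaRatio / √(c / (ϰ * Real.log T)) +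
            Real.pi * √v / (c / (ϰ * Real.log T)))) := by
  have hL : 0 < Real.log T := Real.log_pos hT
  have hT0 : 0 < T := by linarith
  have hθ' : 1 - θ ≠ 0 := by linarith
  have hexp : ∀ x : ℝ, (T ^ ϰ) ^ (x / (ϰ * Real.log T)) = Real.exp x := fun x => by
    rw [Real.rpow_def_of_pos (by positivity), Real.log_rpow hT0]
    congr 1
    field_simp
  have hN : ((d : ℝ) * q / ((d.totient : ℝ) * q.totient * Real.log T)) =
      ((q * d : ℕ) / (q * d).totient : ℝ) / Real.log T := by
    rw [Nat.totient_mul hqd]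
    push_cast
    rw [div_div]
    ring_nf
  rw [sumBound, boundFactor, hN, Real.sqrt_div (by positivity), ← mul_div_assoc θ, hexp, hexp,
    mul_comm θ c, Real.log_rpow hT0, Real.sqrt_div hc.le, Real.sqrt_div (by positivity),
    Real.sqrt_mul hv, Real.sqrt_mul (by positivity) c, Real.sqrt_mul hϰ.le, Real.sqrt_mul Real.pi_pos.le]
  have e1 := Real.mul_self_sqrt Real.pi_pos.le
  have e2 := Real.mul_self_sqrt hϰ.le
  have e3 := Real.mul_self_sqrt hL.le
  have e4 := Real.mul_self_sqrt hc.le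
  have p1 := Real.sqrt_pos.mpr Real.pi_pos
  have p2 := Real.sqrt_pos.mpr hϰ
  have p3 := Real.sqrt_pos.mpr hL
  have p4 := Real.sqrt_pos.mpr hc
  generalize √((q * d : ℕ) / (q * d).totient : ℝ) = N
  generalize Real.exp (c * θ) = E₁
  generalize Real.exp c = E₂
  generalize √Real.pi = x₁ at *
  generalize √ϰ = x₂ at *
  generalize √(Real.log T) = x₃ at *
  generalize √c = x₄ at *
  rw [← e1, ← e2, ← e3, ← e4]
  field_simp
  ring

theorem mainTheorem7 (ϰ θ A : ℝ) (hϰ : 0 < ϰ) (hθ0 : 0 < θ) (hθ1 : θ < 1) (hA : 0 < A) :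
    ∃ ρ : ℝ → ℝ,
      -- `ρ u` is the only positive solution of the equation, and the only minimizer of the bound
      (∀ u : ℝ, 0 ≤ u →
        (0 < ρ u ∧ optimalityFn ϰ θ u (ρ u) = 0) ∧
        (∀ X : ℝ, 0 < X → optimalityFn ϰ θ u X = 0 → X = ρ u) ∧
        (∀ c : ℝ, 0 < c → c ≠ ρ u → boundFactor ϰ θ u (ρ u) < boundFactor ϰ θ u c)) ∧
      -- the asymptotic bound, uniformly in `q`, `d`, `δ`, `v`, for every `c > 0` and for `c = ρ`
      (∀ ε : ℝ, 0 < ε → ∀ᶠ T : ℝ in Filter.atTop,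
        ∀ q d δ : ℕ, 1 ≤ q → 1 ≤ d → 1 ≤ δ → (d : ℝ) ≤ T ^ (2 * ϰ) → Nat.Coprime q d →
          DvdInfPow δ d → ∀ v : ℝ, 0 ≤ v → v ≤ A / Real.log T →
            (∀ c : ℝ, 0 < c →
              ‖twistedSum ϰ θ T q d δ v‖ ≤ (1 + ε) * sumBound ϰ θ T q d δ v c) ∧
            ‖twistedSum ϰ θ T q d δ v‖ ≤
              (1 + ε) * sumBound ϰ θ T q d δ v (ρ (v * Real.log T))) := by
  choose! ρ hρ using fun (u : ℝ) (hu : 0 ≤ u) => exists_optimal_parameter hϰ hθ0 hθ1 hu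
  have hρ0 : ∀ u, 0 ≤ u → 0 < ρ u := fun u hu => lt_of_lt_of_le (by norm_num) (hρ u hu).1.1
  refine ⟨ρ, fun u hu => ⟨⟨hρ0 u hu, (hρ u hu).2.1⟩, (hρ u hu).2.2.1, (hρ u hu).2.2.2⟩, ?_⟩
  intro ε hε
  obtain ⟨σ₀, hσ₀, v₀, hv₀, H⟩ := exists_integrable_majorant hε
  -- The two thresholds give `ρ / (ϰ log T) ≤ 1 / (θ ϰ log T) ≤ σ₀` and `v ≤ A / log T ≤ v₀`;
  -- neither involves `q`, `d`, `δ`, `v` or `c`.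
  filter_upwards [Filter.eventually_gt_atTop 1,
    Real.tendsto_log_atTop.eventually_ge_atTop (1 / (θ * ϰ * σ₀)),
    Real.tendsto_log_atTop.eventually_ge_atTop (A / v₀)] with T hT hT1 hT2
  intro q d δ hq hd hδ _ hqd hδd v hv hvA
  have hL : 0 < Real.log T := Real.log_pos hT
  have hu : 0 ≤ v * Real.log T := by positivity
  have hmain : ‖twistedSum ϰ θ T q d δ v‖ ≤
      (1 + ε) * sumBound ϰ θ T q d δ v (ρ (v * Real.log T)) := by
    have hc := hρ0 _ hu
    have hcθ := (hρ _ hu).1.2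
    set c := ρ (v * Real.log T)
    have hσ : 0 < c / (ϰ * Real.log T) := by positivity
    have hσle : c / (ϰ * Real.log T) ≤ σ₀ := by
      rw [div_le_iff₀ (by positivity)]
      refine hcθ.trans ?_
      rw [div_le_iff₀ (by positivity)] at hT1 ⊢
      linarith
    have hvle : v ≤ v₀ := by
      refine hvA.trans ?_
      rw [div_le_iff₀ hv₀] at hT2
      rw [div_le_iff₀ hL]
      linarith
    obtain ⟨g, hg, hζg, hgint⟩ := H _ v hσ hσle hv hvle
    have hξ : 1 < T ^ ϰ := Real.one_lt_rpow hT hϰ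
    have hlξ : 0 < Real.log (T ^ ϰ) := Real.log_pos hξ
    have hθ' : 0 < 1 - θ := by linarith
    have hT0 : 0 < T := by linarith
    refine (norm_twistedSum_le hθ0 hθ1 hξ (Nat.mul_ne_zero (by omega) (by omega)) hδ hδd hσ hg
      hζg).trans ?_
    rw [sumBound_eq hϰ hθ1 hT hqd hv hc]
    have hpre : 0 ≤ tauZ (1 / 2) δ / (2 * Real.pi * ((1 - θ) * Real.log (T ^ ϰ))) :=
      div_nonneg (tauZ_half_nonneg δ) (by have := Real.pi_pos; positivity)
    refine (mul_le_mul_of_nonneg_left (mul_le_mul_of_nonneg_left hgint (by positivity))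
      hpre).trans_eq ?_
    ring
  -- Arbitrary `c`, however large or small, follows from `c = ρ` by minimality.
  refine ⟨fun c hc => hmain.trans ?_, hmain⟩
  have hle : boundFactor ϰ θ (v * Real.log T) (ρ (v * Real.log T)) ≤
      boundFactor ϰ θ (v * Real.log T) c := by
    rcases eq_or_ne c (ρ (v * Real.log T)) with h | h
    · rw [h]
    · exact ((hρ _ hu).2.2.2 c hc h).le
  refine mul_le_mul_of_nonneg_left ?_ (by linarith)
  exact mul_le_mul_of_nonneg_right (mul_le_mul_of_nonneg_left hle
    (div_nonneg (tauZ_half_nonneg δ) (by linarith))) (Real.sqrt_nonneg _)
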